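/- Let $(U_n,V_n)_{n\ge 0}$ be the simple random walk on $\mathbb{Z}^2$ started at $(0,0)$, i.e. the walk with i.i.d. steps uniform on $\{(\pm1,0),(0,\pm1)\}$, and let $T=\inf\{n>0: V_n=0\}$, which is almost surely finite. The law of $U_T$ on $\mathbb{Z}$ is called the discrete (symmetric) Cauchy law. Let $(S_n)_{n\ge 0}$ be a process on $\mathbb{Z}$, with an arbitrary law of $S_0$, that makes a discrete Cauchy jump at a first visit to a site and a $\pm1$ symmetric Bernoulli jump at all other visits. That is, for every $n\ge 0$, conditionally on $S_0,\dots,S_n$, the increment $S_{n+1}-S_n$ has the discrete Cauchy law if $S_n\notin\{S_0,\dots,S_{n-1}\}$ (in particular if $n=0$), and takes each of the values $+1$ and $-1$ with probability $1/2$ if $S_n\in\{S_0,\dots,S_{n-1}\}$. Then $$\frac1n\,\sup_{0\le t\le n}|S_t|\longrightarrow 0\quad\text{in probability as } n\to\infty .$$ -/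

import Mathlib

open MeasureTheory Filter Topology

noncomputable section

namespace Benjamini

/-- The four unit steps `(±1, 0)`, `(0, ±1)` of the nearest neighbour walk on `ℤ²`. -/
def unitSteps : Finset (ℤ × ℤ) := {(1, 0), (-1, 0), (0, 1), (0, -1)}

theorem unitSteps_nonempty : unitSteps.Nonempty := ⟨(1, 0), by simp [unitSteps]⟩

/-- The uniform distribution on the four unit steps. -/
def stepLaw : Measure (ℤ × ℤ) := (PMF.uniformOfFinset unitSteps unitSteps_nonempty).toMeasure

instance : IsProbabilityMeasure stepLaw :=
  inferInstanceAs
    (IsProbabilityMeasure (PMF.uniformOfFinset unitSteps unitSteps_nonempty).toMeasure)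

/-- The law of an i.i.d. sequence of uniform unit steps. -/
def srwLaw : Measure (ℕ → ℤ × ℤ) := Measure.infinitePi fun _ : ℕ => stepLaw

/-- Position `(U n, V n)` at time `n` of the walk on `ℤ²` started at `(0, 0)` with steps `ξ`.
Under `srwLaw` this is the simple random walk on `ℤ²`. -/
def walk (ξ : ℕ → ℤ × ℤ) (n : ℕ) : ℤ × ℤ := ∑ i ∈ Finset.range n, ξ i

/-- `n` is the first return time `T = inf {n > 0 : V n = 0}` of the walk to the horizontal axis. -/
def IsFirstReturn (ξ : ℕ → ℤ × ℤ) (n : ℕ) : Prop :=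
  0 < n ∧ (walk ξ n).2 = 0 ∧ ∀ m, 0 < m → m < n → (walk ξ m).2 ≠ 0

/-- Mass function of the discrete (symmetric) Cauchy law, the law of `U T`:
`discreteCauchy y` is the probability that simple random walk on `ℤ²` started at the origin
first returns to the horizontal axis at the point `(y, 0)`. -/
def discreteCauchy (y : ℤ) : ENNReal :=
  srwLaw {ξ | ∃ n, IsFirstReturn ξ n ∧ (walk ξ n).1 = y}

/-- Mass function of the symmetric Bernoulli law: mass `1/2` on each of `1` and `-1`. -/
def symmBernoulli (y : ℤ) : ENNReal := if y = 1 ∨ y = -1 then 1 / 2 else 0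

/-- At time `n` the path `x` is at a site that it has not visited before. -/
def IsFresh (x : ℕ → ℤ) (n : ℕ) : Prop := ∀ k < n, x k ≠ x n

open Classical in
/-- Mass function of the jump made at time `n` by a path that has followed `x` up to time `n`. -/
def jumpMass (x : ℕ → ℤ) (n : ℕ) (y : ℤ) : ENNReal :=
  if IsFresh x n then discreteCauchy y else symmBernoulli y

/-- `S` is a Benjamini process on `ℤ`, with arbitrary initial law: given `S 0, …, S n`, the jump
`S (n + 1) - S n` has the discrete Cauchy law if `S n` is visited for the first time at time `n`,
and the symmetric `±1` Bernoulli law otherwise. As `ℤ` is countable, the conditional law is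
expressed on the events `S 0 = x 0, …, S n = x n`. -/
structure IsBenjaminiProcess {Ω : Type*} [MeasurableSpace Ω] (P : Measure Ω)
    (S : ℕ → Ω → ℤ) : Prop where
  measurable : ∀ n, Measurable (S n)
  jump : ∀ (n : ℕ) (x : ℕ → ℤ),
    P {ω | ∀ k ≤ n + 1, S k ω = x k} =
      P {ω | ∀ k ≤ n, S k ω = x k} * jumpMass x n (x (n + 1) - x n)

/-- The running maximum `sup_{t ≤ n} |S t|`. -/
def runningMax {Ω : Type*} (S : ℕ → Ω → ℤ) (n : ℕ) (ω : Ω) : ℝ :=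
  (Finset.range (n + 1)).sup' Finset.nonempty_range_add_one fun t => |(S t ω : ℝ)|

end Benjamini

end

/-!
The proof rests on two functions that are superharmonic, off the horizontal axis, for the simple
random walk `(U, V)` on `ℤ²`. If `B ≥ 0` is such a function, then stopping the walk at its first
return to the axis shows that the mean of `B (·, 0)` after a discrete Cauchy jump from `x` is at most
the mean of `B` after one step of the planar walk from `(x, 0)` (`tsum_discreteCauchy_mul_le`).
Hence no asymptotics of the discrete Cauchy law are needed.

*The range is sublinear.* The function `log (2 x² + 2 (|y| + 1)² - 1)` (`logPotential`) is
superharmonic off the axis. Write `a x` for its value `log (2 x² + 1)` at `(x, 0)`. Both a discrete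
Cauchy jump and a `±1` jump from `x` raise `a` in mean by at most `5 / (2 x² + 1)`, which is summable
over `x`. Consider the energy `F n = ∑ w, a (S n - w)`, the sum being over the sites `w` visited
before time `n` (`logEnergy`). A site that enters the sum does so with the term `a 0 = 0`, and in each
step the drifts of the terms have distinct arguments `S n - w`; hence `𝔼 (F n) ≤ K n`
(`logEnergy_step`). On the other hand, all but `2 m` of the `N n` terms are at least
`log (2 m² + 1)`, so `𝔼 (N n) ≤ 2 m + K n / log (2 m² + 1)` for every `m`, and `𝔼 (N n) / n → 0`
(`IsBenjaminiProcess.tendsto_meanRange_div`).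

*The displacement.* The function `min (x² + 2 L |y| - y²) (L²)`, continued by `L²` for `|y| ≥ L`
(`truncQuad`), is also superharmonic off the axis. It shows that a discrete Cauchy jump raises the
truncated square `min (x²) (L²)` of the displacement in mean by at most `L`, while a `±1` jump raises
it by at most `1`. Freezing the truncated square when the displacement reaches `L` and using Markov's
inequality gives
`P (max_{t ≤ n} |S t - S 0| ≥ L) ≤ (L 𝔼 (N n) + n) / L²`
(`IsBenjaminiProcess.measure_displacement_le`), because discrete Cauchy jumps are made only from
fresh sites. For `L` proportional to `n` the right-hand side tends to `0`.
-/

noncomputable section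

namespace Benjamini

/-! ### Processes with prescribed jump masses on a countable space -/

section History

variable {Ω α : Type*} {S : ℕ → Ω → α}

/-- The path that follows the finite history `h` and then stays at its last site. -/
def extendHistory {n : ℕ} (h : Fin (n + 1) → α) : ℕ → α := fun k => h ⟨min k n, by omega⟩

/-- The history up to time `n` of the process `S`. -/
def history (S : ℕ → Ω → α) (n : ℕ) (ω : Ω) : Fin (n + 1) → α := fun i => S i ω

theorem extendHistory_history {n k : ℕ} (hk : k ≤ n) (ω : Ω) :
    extendHistory (history S n ω) k = S k ω := by
  simp [extendHistory, history, hk]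

theorem forall_eq_extendHistory_iff {n : ℕ} (h : Fin (n + 1) → α) (ω : Ω) :
    (∀ k ≤ n, S k ω = extendHistory h k) ↔ history S n ω = h := by
  constructor
  · intro H
    ext i
    have hi : (i : ℕ) ≤ n := by omega
    simpa [extendHistory, history, hi] using H i hi
  · rintro rfl k hk
    exact (extendHistory_history hk ω).symm

variable [MeasurableSpace Ω] {P : Measure Ω} [MeasurableSpace α]

theorem measurable_history (hS : ∀ n, Measurable (S n)) (n : ℕ) : Measurable (history S n) :=
  measurable_pi_iff.2 fun i => hS i

variable [Countable α] [MeasurableSingletonClass α]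

/-- A functional of finitely many positions of a process on a countable space is measurable. -/
theorem measurable_comp_of_dependsOn {β : Type*} [MeasurableSpace β]
    (hS : ∀ n, Measurable (S n)) {n : ℕ} {f : (ℕ → α) → β} (hf : DependsOn f (Set.Iic n)) :
    Measurable fun ω => f fun k => S k ω := by
  have : (fun ω => f fun k => S k ω) = (fun h => f (extendHistory h)) ∘ history S n := by
    ext ω
    exact hf fun k hk => (extendHistory_history hk ω).symm
  rw [this]
  exact (Measurable.of_discrete).comp (measurable_history hS n)

/-- One-step drift inequality: if, given the path up to time `n`, the mean of `Ψ` at time `n + 1`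
exceeds `Φ` by at most `c`, then the same holds for the unconditional means. -/
theorem lintegral_succ_le (hS : ∀ n, Measurable (S n)) {mass : (ℕ → α) → α → ENNReal} {n : ℕ}
    (hmass : DependsOn mass (Set.Iic n))
    (hjump : ∀ x : ℕ → α, P {ω | ∀ k ≤ n + 1, S k ω = x k} =
      P {ω | ∀ k ≤ n, S k ω = x k} * mass x (x (n + 1)))
    {Φ Ψ c : (ℕ → α) → ENNReal} (hΦ : DependsOn Φ (Set.Iic n))
    (hΨ : DependsOn Ψ (Set.Iic (n + 1))) (hc : DependsOn c (Set.Iic n))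
    (hstep : ∀ x, ∑' z, mass x z * Ψ (Function.update x (n + 1) z) ≤ Φ x + c x) :
    ∫⁻ ω, Ψ (fun k => S k ω) ∂P ≤
      ∫⁻ ω, Φ (fun k => S k ω) ∂P + ∫⁻ ω, c (fun k => S k ω) ∂P := by
  have hH := measurable_history hS n
  -- the history up to time `n + 1` is split into the history up to time `n` and the next position
  have hJ : Measurable fun ω => (history S n ω, S (n + 1) ω) := hH.prodMk (hS (n + 1))
  have hpoint : ∀ (h : Fin (n + 1) → α) (z : α),
      P.map (fun ω => (history S n ω, S (n + 1) ω)) {(h, z)} =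
        P.map (history S n) {h} * mass (extendHistory h) z := by
    intro h z
    rw [Measure.map_apply hJ (measurableSet_singleton _),
      Measure.map_apply hH (measurableSet_singleton _)]
    have hagree : ∀ k ≤ n, Function.update (extendHistory h) (n + 1) z k = extendHistory h k :=
      fun k hk => Function.update_of_ne (by omega) _ _
    have key := hjump (Function.update (extendHistory h) (n + 1) z)
    rw [Function.update_self, hmass (x := Function.update (extendHistory h) (n + 1) z)
      (y := extendHistory h) hagree] at key
    have e1 : {ω | ∀ k ≤ n + 1, S k ω = Function.update (extendHistory h) (n + 1) z k} =
        (fun ω => (history S n ω, S (n + 1) ω)) ⁻¹' {(h, z)} := by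
      ext ω
      simp only [Set.mem_ofPred_eq, Set.mem_preimage, Set.mem_singleton_iff, Prod.mk.injEq,
        ← forall_eq_extendHistory_iff]
      constructor
      · intro H
        exact ⟨fun k hk => (H k (by omega)).trans (hagree k hk),
          (H (n + 1) le_rfl).trans (Function.update_self _ _ _)⟩
      · rintro ⟨H, hz⟩ k hk
        rcases Nat.lt_or_ge n k with hlt | hle
        · obtain rfl : k = n + 1 := by omega
          rw [Function.update_self, hz]
        · rw [hagree k hle, H k hle]
    have e2 : {ω | ∀ k ≤ n, S k ω = Function.update (extendHistory h) (n + 1) z k} =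
        history S n ⁻¹' {h} := by
      ext ω
      simp only [Set.mem_ofPred_eq, Set.mem_preimage, Set.mem_singleton_iff,
        ← forall_eq_extendHistory_iff]
      exact forall₂_congr fun k hk => by rw [hagree k hk]
    rwa [e1, e2] at key
  have hΨint : ∫⁻ ω, Ψ (fun k => S k ω) ∂P =
      ∑' h : Fin (n + 1) → α, P.map (history S n) {h} *
        ∑' z, mass (extendHistory h) z * Ψ (Function.update (extendHistory h) (n + 1) z) := by
    have e : ∀ ω, Ψ (fun k => S k ω) = (fun p : (Fin (n + 1) → α) × α =>
        Ψ (Function.update (extendHistory p.1) (n + 1) p.2)) (history S n ω, S (n + 1) ω) := by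
      intro ω
      refine hΨ fun k hk => ?_
      rcases Nat.lt_or_ge n k with hlt | hle
      · obtain rfl : k = n + 1 := le_antisymm hk hlt
        simp
      · simp only [Function.update_of_ne (show k ≠ n + 1 by omega)]
        exact (extendHistory_history hle ω).symm
    simp_rw [e]
    rw [← lintegral_map (μ := P) (f := fun p : (Fin (n + 1) → α) × α =>
      Ψ (Function.update (extendHistory p.1) (n + 1) p.2)) Measurable.of_discrete hJ,
      lintegral_countable', ENNReal.tsum_prod']
    refine tsum_congr fun h => ?_
    rw [← ENNReal.tsum_mul_left]
    refine tsum_congr fun z => ?_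
    rw [hpoint]
    ring
  have hint : ∀ f : (ℕ → α) → ENNReal, DependsOn f (Set.Iic n) →
      ∫⁻ ω, f (fun k => S k ω) ∂P =
        ∑' h : Fin (n + 1) → α, P.map (history S n) {h} * f (extendHistory h) := by
    intro f hf
    have e : ∀ ω, f (fun k => S k ω) = (fun h => f (extendHistory h)) (history S n ω) :=
      fun ω => hf fun k hk => (extendHistory_history hk ω).symm
    simp_rw [e]
    rw [← lintegral_map (μ := P) (f := fun h : Fin (n + 1) → α => f (extendHistory h))
      Measurable.of_discrete hH, lintegral_countable']
    exact tsum_congr fun h => mul_comm _ _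
  rw [hΨint, hint Φ hΦ, hint c hc, ← ENNReal.tsum_add]
  refine ENNReal.tsum_le_tsum fun h => ?_
  rw [← mul_add]
  gcongr
  exact hstep _

end History

/-! ### The discrete Cauchy law and superharmonic functions -/

theorem stepLaw_singleton (e : ℤ × ℤ) : stepLaw {e} = if e ∈ unitSteps then 1 / 4 else 0 := by
  rw [stepLaw, PMF.toMeasure_apply_singleton _ _ (measurableSet_singleton _),
    PMF.uniformOfFinset_apply]
  have : unitSteps.card = 4 := by decide
  simp [this]

theorem tsum_stepLaw_mul (g : ℤ × ℤ → ENNReal) :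
    ∑' e, stepLaw {e} * g e = (g (1, 0) + g (-1, 0) + g (0, 1) + g (0, -1)) / 4 := by
  rw [tsum_eq_sum (s := unitSteps) fun e he => by simp [stepLaw_singleton, he]]
  simp [stepLaw_singleton, unitSteps, ENNReal.div_eq_inv_mul]
  ring

theorem srwLaw_forall_le_eq (x : ℕ → ℤ × ℤ) (n : ℕ) :
    srwLaw {ξ | ∀ k ≤ n, ξ k = x k} = ∏ k ∈ Finset.range (n + 1), stepLaw {x k} := by
  rw [srwLaw, ← Measure.infinitePi_pi (fun _ => stepLaw) fun i _ => measurableSet_singleton (x i)]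
  congr 1
  ext ξ
  simp [Set.mem_pi]

instance : IsProbabilityMeasure srwLaw :=
  inferInstanceAs (IsProbabilityMeasure (Measure.infinitePi fun _ : ℕ => stepLaw))

/-- Position at time `n + 1` of the walk with steps `ξ`, stopped at its first return to the
horizontal axis. The index is shifted so that the value depends on `ξ 0, …, ξ n`. -/
def stoppedWalk (ξ : ℕ → ℤ × ℤ) : ℕ → ℤ × ℤ
  | 0 => ξ 0
  | n + 1 => if (stoppedWalk ξ n).2 = 0 then stoppedWalk ξ n else stoppedWalk ξ n + ξ (n + 1)

theorem dependsOn_stoppedWalk (n : ℕ) :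
    DependsOn (fun ξ => stoppedWalk ξ n) (Set.Iic n) := by
  induction n with
  | zero => exact fun x y h => h 0 (by simp)
  | succ n ih =>
    intro x y h
    have h1 : stoppedWalk x n = stoppedWalk y n :=
      ih fun k hk => h k (Set.Iic_subset_Iic.2 n.le_succ hk)
    have h2 : x (n + 1) = y (n + 1) := h (n + 1) (by simp)
    simp only [stoppedWalk, h1, h2]

theorem IsFirstReturn.stoppedWalk_eq {ξ : ℕ → ℤ × ℤ} {n : ℕ} (h : IsFirstReturn ξ n) {m : ℕ}
    (hm : n ≤ m + 1) : stoppedWalk ξ m = walk ξ n := by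
  obtain ⟨hn, h0, hne⟩ := h
  have before : ∀ k, k + 1 ≤ n → stoppedWalk ξ k = walk ξ (k + 1) := by
    intro k
    induction k with
    | zero => intro _; simp [stoppedWalk, walk]
    | succ k ih =>
      intro hk
      have hk' := ih (by omega)
      have := hne (k + 1) (by omega) (by omega)
      rw [stoppedWalk, hk', if_neg this, walk, walk, Finset.sum_range_succ _ (k + 1)]
  obtain ⟨j, rfl⟩ : ∃ j, n = j + 1 := ⟨n - 1, by omega⟩
  have after : ∀ d, stoppedWalk ξ (j + d) = walk ξ (j + 1) := by
    intro d
    induction d with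
    | zero => exact before j le_rfl
    | succ d ih => rw [← add_assoc, stoppedWalk, ih, if_pos h0]
  obtain ⟨d, rfl⟩ : ∃ d, m = j + d := ⟨m - j, by omega⟩
  exact after d

theorem IsFirstReturn.unique {ξ : ℕ → ℤ × ℤ} {m n : ℕ} (hm : IsFirstReturn ξ m)
    (hn : IsFirstReturn ξ n) : m = n := by
  rcases lt_trichotomy m n with h | h | h
  · exact absurd hm.2.1 (hn.2.2 m hm.1 h)
  · exact h
  · exact absurd hn.2.1 (hm.2.2 n hn.1 h)

theorem measurableSet_firstReturn (y : ℤ) :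
    MeasurableSet {ξ | ∃ n, IsFirstReturn ξ n ∧ (walk ξ n).1 = y} := by
  refine measurableSet_setOfPred.2 (Measurable.exists fun n => ?_)
  refine measurable_comp_of_dependsOn (S := fun n (ξ : ℕ → ℤ × ℤ) => ξ n) measurable_pi_apply
    (n := n) (f := fun ξ => IsFirstReturn ξ n ∧ (walk ξ n).1 = y) fun ξ ζ h => ?_
  have hw : ∀ m ≤ n, walk ξ m = walk ζ m := fun m hm =>
    Finset.sum_congr rfl fun i hi => h i (by have := Finset.mem_range.1 hi; simp; omega)
  have hall : (∀ m, 0 < m → m < n → (walk ξ m).2 ≠ 0) ↔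
      ∀ m, 0 < m → m < n → (walk ζ m).2 ≠ 0 :=
    forall_congr' fun m => forall₂_congr fun _ hm => by rw [hw m hm.le]
  simp only [IsFirstReturn, hw n le_rfl, hall]

/-- Optional stopping for the walk killed on the horizontal axis: if `A ≥ 0` is superharmonic for
simple random walk on `ℤ²` off the horizontal axis, then its mean after a discrete Cauchy jump
from `x` is at most its mean after one step of the planar walk from `(x, 0)`. -/
theorem tsum_discreteCauchy_mul_le (A : ℤ → ℤ → ENNReal)
    (hA : ∀ x y, y ≠ 0 → (A (x + 1) y + A (x - 1) y + A x (y + 1) + A x (y - 1)) / 4 ≤ A x y)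
    (x : ℤ) :
    ∑' y, discreteCauchy y * A (x + y) 0 ≤
      (A (x + 1) 0 + A (x - 1) 0 + A x 1 + A x (-1)) / 4 := by
  set Φ : ℕ → (ℕ → ℤ × ℤ) → ENNReal :=
    fun n ξ => A (x + (stoppedWalk ξ n).1) (stoppedWalk ξ n).2 with hΦ
  have hcoord : ∀ n, Measurable fun ξ : ℕ → ℤ × ℤ => ξ n := fun n => measurable_pi_apply n
  have hdep : ∀ n, DependsOn (Φ n) (Set.Iic n) := fun n ξ ζ h => by
    have : stoppedWalk ξ n = stoppedWalk ζ n := dependsOn_stoppedWalk n h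
    simp only [hΦ, this]
  have hmean : ∀ n, ∫⁻ ξ, Φ n ξ ∂srwLaw ≤
      (A (x + 1) 0 + A (x - 1) 0 + A x 1 + A x (-1)) / 4 := by
    intro n
    induction n with
    | zero =>
      have h0 : ∫⁻ ξ, Φ 0 ξ ∂srwLaw = ∫⁻ e, A (x + e.1) e.2 ∂stepLaw := by
        have hmap : srwLaw.map (fun ξ => ξ 0) = stepLaw :=
          (measurePreserving_eval_infinitePi (fun _ : ℕ => stepLaw) 0).map_eq
        rw [← hmap, lintegral_map Measurable.of_discrete (hcoord 0)]
        rfl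
      rw [h0, lintegral_countable']
      simp_rw [mul_comm _ (stepLaw _)]
      rw [tsum_stepLaw_mul]
      simp [sub_eq_add_neg]
    | succ n ih =>
      refine le_trans ?_ ih
      have := lintegral_succ_le (P := srwLaw) (S := fun n ξ => ξ n) hcoord
        (mass := fun _ e => stepLaw {e}) (n := n) (fun _ _ _ => rfl)
        (fun ζ => by rw [srwLaw_forall_le_eq, srwLaw_forall_le_eq, Finset.prod_range_succ])
        (hdep n) (hdep (n + 1)) (c := fun _ => 0) (fun _ _ _ => rfl) ?_
      · simpa using this
      intro ζ
      rw [add_zero, tsum_stepLaw_mul]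
      have hupd : ∀ e, stoppedWalk (Function.update ζ (n + 1) e) (n + 1) =
          if (stoppedWalk ζ n).2 = 0 then stoppedWalk ζ n else stoppedWalk ζ n + e := by
        intro e
        have : stoppedWalk (Function.update ζ (n + 1) e) n = stoppedWalk ζ n :=
          dependsOn_stoppedWalk n fun k hk =>
            Function.update_of_ne (by have := Set.mem_Iic.1 hk; omega) _ _
        rw [stoppedWalk, this, Function.update_self]
      simp only [hΦ, hupd]
      split_ifs with h
      · refine le_of_eq ?_
        rw [ENNReal.div_eq_inv_mul]
        generalize A (x + (stoppedWalk ζ n).1) (stoppedWalk ζ n).2 = a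
        rw [show a + a + a + a = 4 * a by ring, ← mul_assoc,
          ENNReal.inv_mul_cancel (by norm_num) (by norm_num), one_mul]
      · have := hA (x + (stoppedWalk ζ n).1) (stoppedWalk ζ n).2 h
        simpa [sub_eq_add_neg, add_assoc] using this
  -- at the first return the stopped walk is frozen at `(U T, 0)`
  have hpoint : ∀ ξ, ∑' y, Set.indicator {ξ | ∃ n, IsFirstReturn ξ n ∧ (walk ξ n).1 = y}
      (fun _ => A (x + y) 0) ξ ≤ liminf (fun n => Φ n ξ) atTop := by
    intro ξ
    by_cases h : ∃ n, IsFirstReturn ξ n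
    · obtain ⟨n, hn⟩ := h
      have hev : ∀ᶠ m in atTop, Φ m ξ = A (x + (walk ξ n).1) 0 := by
        filter_upwards [eventually_ge_atTop n] with m hm
        simp only [hΦ, hn.stoppedWalk_eq (show n ≤ m + 1 by omega), hn.2.1]
      rw [Filter.liminf_congr hev, liminf_const, tsum_eq_single (walk ξ n).1]
      · exact Set.indicator_le_self _ _ _
      · intro y hy
        refine Set.indicator_of_notMem ?_ _
        rintro ⟨m, hm, hmy⟩
        exact hy (by rw [← hmy, hm.unique hn])
    · refine le_of_eq_of_le (ENNReal.tsum_eq_zero.2 fun y => ?_) zero_le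
      refine Set.indicator_of_notMem ?_ _
      rintro ⟨m, hm, -⟩
      exact h ⟨m, hm⟩
  calc ∑' y, discreteCauchy y * A (x + y) 0
      = ∫⁻ ξ, ∑' y, Set.indicator {ξ | ∃ n, IsFirstReturn ξ n ∧ (walk ξ n).1 = y}
          (fun _ => A (x + y) 0) ξ ∂srwLaw := by
        rw [lintegral_tsum fun y =>
          (measurable_const.indicator (measurableSet_firstReturn y)).aemeasurable]
        refine tsum_congr fun y => ?_
        rw [lintegral_indicator_const (measurableSet_firstReturn y), mul_comm, discreteCauchy]
    _ ≤ ∫⁻ ξ, liminf (fun n => Φ n ξ) atTop ∂srwLaw := lintegral_mono hpoint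
    _ ≤ liminf (fun n => ∫⁻ ξ, Φ n ξ ∂srwLaw) atTop :=
        lintegral_liminf_le fun n => measurable_comp_of_dependsOn hcoord (hdep n)
    _ ≤ _ := by
        refine (liminf_le_liminf (Eventually.of_forall hmean)).trans_eq (liminf_const _)

/-- Real-valued form of `tsum_discreteCauchy_mul_le`. -/
theorem tsum_discreteCauchy_mul_ofReal_le (B : ℤ → ℤ → ℝ) (hB0 : ∀ x y, 0 ≤ B x y)
    (hB : ∀ x y, y ≠ 0 → B (x + 1) y + B (x - 1) y + B x (y + 1) + B x (y - 1) ≤ 4 * B x y)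
    (x : ℤ) :
    ∑' y, discreteCauchy y * ENNReal.ofReal (B (x + y) 0) ≤
      ENNReal.ofReal ((B (x + 1) 0 + B (x - 1) 0 + B x 1 + B x (-1)) / 4) := by
  have hdiv : ∀ a b c d : ℝ, 0 ≤ a → 0 ≤ b → 0 ≤ c → 0 ≤ d →
      (ENNReal.ofReal a + ENNReal.ofReal b + ENNReal.ofReal c + ENNReal.ofReal d) / 4 =
        ENNReal.ofReal ((a + b + c + d) / 4) := by
    intro a b c d ha hb hc hd
    rw [ENNReal.ofReal_div_of_pos (by norm_num), ENNReal.ofReal_add (by positivity) hd,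
      ENNReal.ofReal_add (by positivity) hc, ENNReal.ofReal_add ha hb]
    norm_num
  have := tsum_discreteCauchy_mul_le (fun x y => ENNReal.ofReal (B x y)) (fun x y hy => by
    rw [hdiv _ _ _ _ (hB0 _ _) (hB0 _ _) (hB0 _ _) (hB0 _ _)]
    exact ENNReal.ofReal_le_ofReal (by linarith [hB x y hy])) x
  rwa [hdiv _ _ _ _ (hB0 _ _) (hB0 _ _) (hB0 _ _) (hB0 _ _)] at this

theorem tsum_discreteCauchy_le_one : ∑' y, discreteCauchy y ≤ 1 := by
  have := tsum_discreteCauchy_mul_ofReal_le (fun _ _ => 1) (fun _ _ => zero_le_one)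
    (fun _ _ _ => by norm_num) 0
  norm_num at this
  exact this

theorem tsum_symmBernoulli_mul (g : ℤ → ENNReal) :
    ∑' y, symmBernoulli y * g y = (g 1 + g (-1)) / 2 := by
  rw [tsum_eq_sum (s := {1, -1}) fun y hy => ?_]
  · simp [symmBernoulli, ENNReal.div_eq_inv_mul]
    ring
  · simp only [Finset.mem_insert, Finset.mem_singleton] at hy
    simp [symmBernoulli, hy]

theorem tsum_symmBernoulli_mul_ofReal (g : ℤ → ℝ) (hg : ∀ y, 0 ≤ g y) (x : ℤ) :
    ∑' y, symmBernoulli y * ENNReal.ofReal (g (x + y)) =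
      ENNReal.ofReal ((g (x + 1) + g (x - 1)) / 2) := by
  rw [tsum_symmBernoulli_mul, ENNReal.ofReal_div_of_pos (by norm_num),
    ENNReal.ofReal_add (hg _) (hg _)]
  simp [sub_eq_add_neg]

theorem tsum_jumpMass_le_one (x : ℕ → ℤ) (n : ℕ) : ∑' y, jumpMass x n y ≤ 1 := by
  unfold jumpMass
  split_ifs
  · exact tsum_discreteCauchy_le_one
  · have := tsum_symmBernoulli_mul fun _ => 1
    simp only [mul_one] at this
    rw [this]
    norm_num [ENNReal.div_self]

/-! ### A logarithmic superharmonic function -/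

/-- A discrete substitute for `log (x² + y²)`, superharmonic for simple random walk on `ℤ²` off
the horizontal axis. The vertical shift by one keeps it finite and nonnegative, and it vanishes at
the origin. -/
def logPotential (x y : ℤ) : ℝ := Real.log (2 * x ^ 2 + 2 * (|(y : ℝ)| + 1) ^ 2 - 1)

theorem logPotential_nonneg (x y : ℤ) : 0 ≤ logPotential x y :=
  Real.log_nonneg (by nlinarith [sq_nonneg (x : ℝ), abs_nonneg (y : ℝ)])

theorem logPotential_zero_right (x : ℤ) : logPotential x 0 = Real.log (2 * x ^ 2 + 1) := by
  unfold logPotential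
  norm_num
  ring_nf

theorem log_superharmonic_aux {x Y : ℝ} (hY : 2 ≤ Y) :
    Real.log (2 * (x + 1) ^ 2 + 2 * Y ^ 2 - 1) + Real.log (2 * (x - 1) ^ 2 + 2 * Y ^ 2 - 1) +
      Real.log (2 * x ^ 2 + 2 * (Y + 1) ^ 2 - 1) + Real.log (2 * x ^ 2 + 2 * (Y - 1) ^ 2 - 1) ≤
      4 * Real.log (2 * x ^ 2 + 2 * Y ^ 2 - 1) := by
  have hY2 : 4 ≤ Y ^ 2 := by nlinarith
  have h1 : 0 < 2 * (x + 1) ^ 2 + 2 * Y ^ 2 - 1 := by nlinarith [sq_nonneg (x + 1)]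
  have h2 : 0 < 2 * (x - 1) ^ 2 + 2 * Y ^ 2 - 1 := by nlinarith [sq_nonneg (x - 1)]
  have h3 : 0 < 2 * x ^ 2 + 2 * (Y + 1) ^ 2 - 1 := by nlinarith [sq_nonneg x]
  have h4 : 0 < 2 * x ^ 2 + 2 * (Y - 1) ^ 2 - 1 := by nlinarith [sq_nonneg x]
  rw [← Real.log_mul h1.ne' h2.ne', ← Real.log_mul (by positivity) h3.ne',
    ← Real.log_mul (by positivity) h4.ne',
    show (4 : ℝ) * Real.log (2 * x ^ 2 + 2 * Y ^ 2 - 1) =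
      Real.log ((2 * x ^ 2 + 2 * Y ^ 2 - 1) ^ 4) by rw [Real.log_pow]; norm_num]
  refine Real.log_le_log (by positivity) ?_
  -- the two sides differ by `64 (x² - Y²)²`
  nlinarith [sq_nonneg (x ^ 2 - Y ^ 2)]

theorem logPotential_superharmonic (x y : ℤ) (hy : y ≠ 0) :
    logPotential (x + 1) y + logPotential (x - 1) y + logPotential x (y + 1) +
      logPotential x (y - 1) ≤ 4 * logPotential x y := by
  unfold logPotential
  push_cast
  rcases lt_or_gt_of_ne hy with h | h
  · have h' : (y : ℝ) ≤ -1 := by exact_mod_cast (by omega : y ≤ -1)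
    have := log_superharmonic_aux (x := x) (Y := -y + 1) (by linarith)
    rw [abs_of_nonpos (by linarith : (y : ℝ) ≤ 0), abs_of_nonpos (by linarith : (y : ℝ) + 1 ≤ 0),
      abs_of_nonpos (by linarith : (y : ℝ) - 1 ≤ 0)]
    ring_nf at this ⊢
    linarith
  · have h' : (1 : ℝ) ≤ y := by exact_mod_cast (by omega : 1 ≤ y)
    have := log_superharmonic_aux (x := x) (Y := y + 1) (by linarith)
    rw [abs_of_nonneg (by linarith : (0 : ℝ) ≤ y), abs_of_nonneg (by linarith : (0 : ℝ) ≤ y + 1),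
      abs_of_nonneg (by linarith : (0 : ℝ) ≤ (y : ℝ) - 1)]
    ring_nf at this ⊢
    linarith

/-- Bound on the drift of `logPotential · 0` from the site `x`, for both kinds of jump. -/
def logDrift (x : ℤ) : ℝ := 5 / (2 * x ^ 2 + 1)

theorem logPotential_add_le (x : ℤ) :
    logPotential (x + 1) 0 + logPotential (x - 1) 0 ≤ 2 * logPotential x 0 + 8 / (2 * x ^ 2 + 1) := by
  simp only [logPotential_zero_right]
  push_cast
  set q : ℝ := 2 * x ^ 2 + 1 with hq
  have hq1 : 1 ≤ q := by nlinarith [sq_nonneg (x : ℝ)]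
  have hpos : 0 < q ^ 2 := by positivity
  rw [← Real.log_mul (by positivity) (by positivity)]
  have h1 : Real.log ((2 * ((x : ℝ) + 1) ^ 2 + 1) * (2 * ((x : ℝ) - 1) ^ 2 + 1)) ≤
      Real.log (q ^ 2 * (1 + 8 / q ^ 2)) := by
    refine Real.log_le_log (by positivity) ?_
    have e : q ^ 2 * (1 + 8 / q ^ 2) = q ^ 2 + 8 := by field_simp
    rw [e, hq]
    nlinarith [sq_nonneg (x : ℝ)]
  have h2 : Real.log (q ^ 2 * (1 + 8 / q ^ 2)) ≤ 2 * Real.log q + 8 / q ^ 2 := by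
    rw [Real.log_mul hpos.ne' (by positivity), Real.log_pow]
    have := Real.log_le_sub_one_of_pos (show 0 < 1 + 8 / q ^ 2 by positivity)
    push_cast
    linarith
  have h3 : 8 / q ^ 2 ≤ 8 / q := div_le_div_of_nonneg_left (by norm_num) (by positivity) (by nlinarith)
  linarith

theorem logPotential_one_right_le (x : ℤ) :
    logPotential x 1 ≤ logPotential x 0 + 6 / (2 * x ^ 2 + 1) := by
  rw [logPotential_zero_right, logPotential]
  set q : ℝ := 2 * x ^ 2 + 1 with hq
  have hq1 : 0 < q := by positivity
  have e : 2 * (x : ℝ) ^ 2 + 2 * (|((1 : ℤ) : ℝ)| + 1) ^ 2 - 1 = q * (1 + 6 / q) := by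
    rw [mul_add, mul_div_cancel₀ _ hq1.ne', hq]
    norm_num
    ring
  rw [e, Real.log_mul hq1.ne' (by positivity)]
  have := Real.log_le_sub_one_of_pos (show 0 < 1 + 6 / q by positivity)
  linarith

theorem logPotential_neg_right (x y : ℤ) : logPotential x (-y) = logPotential x y := by
  simp [logPotential]

theorem tsum_jumpMass_logPotential_le (p : ℕ → ℤ) (n : ℕ) (x : ℤ) :
    ∑' y, jumpMass p n y * ENNReal.ofReal (logPotential (x + y) 0) ≤
      ENNReal.ofReal (logPotential x 0) + ENNReal.ofReal (logDrift x) := by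
  have h1 := logPotential_add_le x
  have h2 := logPotential_one_right_le x
  have hk : 0 ≤ logDrift x := by unfold logDrift; positivity
  have e8 : 8 / (2 * (x : ℝ) ^ 2 + 1) = 8 / 5 * logDrift x := by unfold logDrift; ring
  have e6 : 6 / (2 * (x : ℝ) ^ 2 + 1) = 6 / 5 * logDrift x := by unfold logDrift; ring
  rw [e8] at h1
  rw [e6] at h2
  rw [← ENNReal.ofReal_add (logPotential_nonneg _ _) hk]
  unfold jumpMass
  split_ifs
  · refine (tsum_discreteCauchy_mul_ofReal_le logPotential logPotential_nonneg
      logPotential_superharmonic x).trans (ENNReal.ofReal_le_ofReal ?_)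
    rw [logPotential_neg_right]
    linarith
  · rw [tsum_symmBernoulli_mul_ofReal (fun y => logPotential y 0)
      fun y => logPotential_nonneg y 0]
    exact ENNReal.ofReal_le_ofReal (by linarith)

theorem tsum_logDrift_ne_top : ∑' x : ℤ, ENNReal.ofReal (logDrift x) ≠ ⊤ := by
  refine Summable.tsum_ofReal_ne_top ?_
  refine Summable.of_norm_bounded_eventually
    ((Real.summable_one_div_int_pow (p := 2)).2 one_lt_two |>.mul_left 5) ?_
  filter_upwards [(Set.finite_singleton (0 : ℤ)).compl_mem_cofinite] with x hx
  have hx' : (x : ℝ) ≠ 0 := by exact_mod_cast hx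
  rw [Real.norm_of_nonneg (by unfold logDrift; positivity), logDrift, mul_one_div]
  exact div_le_div_of_nonneg_left (by norm_num) (by positivity) (by nlinarith [sq_nonneg (x : ℝ)])

/-! ### A truncated quadratic superharmonic function -/

/-- The function `x² + 2 L |y| - y²`, harmonic off the horizontal axis, truncated at height `L²` and
continued by `L²` for `|y| ≥ L`, where it would decrease in `|y|`. Its restriction to the
horizontal axis is `min (x²) (L²)`, while at `(x, ±1)` it exceeds `x²` by at most `2 L - 1`. -/
def truncQuad (L : ℕ) (x y : ℤ) : ℝ :=
  if |y| < L then min ((x : ℝ) ^ 2 + 2 * L * |(y : ℝ)| - (y : ℝ) ^ 2) ((L : ℝ) ^ 2) else (L : ℝ) ^ 2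

theorem truncQuad_le (L : ℕ) (x y : ℤ) : truncQuad L x y ≤ (L : ℝ) ^ 2 := by
  unfold truncQuad
  split_ifs
  exacts [min_le_right _ _, le_rfl]

theorem truncQuad_le_quad {L : ℕ} (x : ℤ) {y : ℤ} (hy : |y| ≤ L) :
    truncQuad L x y ≤ (x : ℝ) ^ 2 + 2 * L * |(y : ℝ)| - (y : ℝ) ^ 2 := by
  unfold truncQuad
  split_ifs with h
  · exact min_le_left _ _
  · have h' : |(y : ℝ)| = L := by exact_mod_cast le_antisymm hy (not_lt.1 h)
    rw [← sq_abs (y : ℝ), h']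
    nlinarith [sq_nonneg (x : ℝ)]

theorem truncQuad_nonneg (L : ℕ) (x y : ℤ) : 0 ≤ truncQuad L x y := by
  unfold truncQuad
  split_ifs with h
  · have h' : |(y : ℝ)| ≤ L := by exact_mod_cast h.le
    rw [← sq_abs (y : ℝ)]
    refine le_min ?_ (by positivity)
    nlinarith [sq_nonneg (x : ℝ), abs_nonneg (y : ℝ)]
  · positivity

theorem truncQuad_neg_right (L : ℕ) (x y : ℤ) : truncQuad L x (-y) = truncQuad L x y := by
  simp [truncQuad]

theorem truncQuad_superharmonic (L : ℕ) (x y : ℤ) (hy : y ≠ 0) :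
    truncQuad L (x + 1) y + truncQuad L (x - 1) y + truncQuad L x (y + 1) +
      truncQuad L x (y - 1) ≤ 4 * truncQuad L x y := by
  wlog h : 0 < y generalizing y
  · have := this (-y) (by omega) (by omega)
    rw [truncQuad_neg_right, truncQuad_neg_right, truncQuad_neg_right,
      show -y + 1 = -(y - 1) by ring, show -y - 1 = -(y + 1) by ring, truncQuad_neg_right,
      truncQuad_neg_right] at this
    linarith
  have b1 := truncQuad_le L (x + 1) y
  have b2 := truncQuad_le L (x - 1) y
  have b3 := truncQuad_le L x (y + 1)
  have b4 := truncQuad_le L x (y - 1)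
  by_cases hL : y < L
  · have e : truncQuad L x y = min ((x : ℝ) ^ 2 + 2 * L * |(y : ℝ)| - (y : ℝ) ^ 2) ((L : ℝ) ^ 2) :=
      if_pos (by rwa [abs_of_pos h])
    have c1 := truncQuad_le_quad (L := L) (x + 1) (y := y) (by rw [abs_of_pos h]; omega)
    have c2 := truncQuad_le_quad (L := L) (x - 1) (y := y) (by rw [abs_of_pos h]; omega)
    have c3 := truncQuad_le_quad (L := L) x (y := y + 1) (by rw [abs_of_pos (by omega)]; omega)
    have c4 := truncQuad_le_quad (L := L) x (y := y - 1) (by rw [abs_of_nonneg (by omega)]; omega)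
    have h1 : (1 : ℝ) ≤ y := by exact_mod_cast (by omega : 1 ≤ y)
    push_cast at c1 c2 c3 c4
    rw [abs_of_nonneg (by linarith)] at c1 c2 c3 c4
    rw [e, abs_of_nonneg (by linarith)]
    rcases min_cases ((x : ℝ) ^ 2 + 2 * L * y - (y : ℝ) ^ 2) ((L : ℝ) ^ 2) with h | h <;>
      rw [h.1] <;> nlinarith
  · have e : truncQuad L x y = (L : ℝ) ^ 2 := if_neg (by rwa [abs_of_pos h])
    linarith

theorem truncQuad_zero_right {L : ℕ} (hL : 0 < L) (x : ℤ) :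
    truncQuad L x 0 = min ((x : ℝ) ^ 2) ((L : ℝ) ^ 2) := by
  simp [truncQuad, hL]

open Classical in
theorem tsum_jumpMass_truncQuad_le {L : ℕ} (hL : 0 < L) (p : ℕ → ℤ) (n : ℕ) (x : ℤ) :
    ∑' y, jumpMass p n y * ENNReal.ofReal (truncQuad L (x + y) 0) ≤
      ENNReal.ofReal (truncQuad L x 0) + (L * (if IsFresh p n then 1 else 0) + 1) := by
  have hL1 : (1 : ℝ) ≤ L := by exact_mod_cast hL
  have b1 := truncQuad_le L (x + 1) 0
  have b2 := truncQuad_le L (x - 1) 0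
  have b3 := truncQuad_le L x 1
  have c1 := truncQuad_le_quad (L := L) (x + 1) (y := 0) (by simp)
  have c2 := truncQuad_le_quad (L := L) (x - 1) (y := 0) (by simp)
  have c3 := truncQuad_le_quad (L := L) x (y := 1) (by rw [abs_one]; omega)
  norm_num at c1 c2 c3
  have h0 := truncQuad_nonneg L x 0
  have e0 := truncQuad_zero_right hL x
  unfold jumpMass
  split_ifs
  · refine (tsum_discreteCauchy_mul_ofReal_le (truncQuad L) (truncQuad_nonneg L)
      (truncQuad_superharmonic L) x).trans ?_
    rw [mul_one, ← ENNReal.ofReal_natCast, ← ENNReal.ofReal_one, ← ENNReal.ofReal_add (by positivity)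
      zero_le_one, ← ENNReal.ofReal_add h0 (by positivity)]
    refine ENNReal.ofReal_le_ofReal ?_
    rw [truncQuad_neg_right]
    rcases min_cases ((x : ℝ) ^ 2) ((L : ℝ) ^ 2) with h | h <;> rw [h.1] at e0 <;> nlinarith
  · rw [tsum_symmBernoulli_mul_ofReal (fun y => truncQuad L y 0) fun y => truncQuad_nonneg L y 0,
      mul_zero, zero_add, ← ENNReal.ofReal_one, ← ENNReal.ofReal_add h0 zero_le_one]
    refine ENNReal.ofReal_le_ofReal ?_
    rcases min_cases ((x : ℝ) ^ 2) ((L : ℝ) ^ 2) with h | h <;> rw [h.1] at e0 <;> nlinarith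

/-! ### Drift inequalities along a Benjamini process -/

theorem isFresh_congr {x y : ℕ → ℤ} {n : ℕ} (h : ∀ k ∈ Set.Iic n, x k = y k) :
    IsFresh x n ↔ IsFresh y n :=
  forall₂_congr fun k hk => by rw [h k (Set.mem_Iic.2 hk.le), h n (Set.mem_Iic.2 le_rfl)]

theorem IsBenjaminiProcess.lintegral_succ_le {Ω : Type*} [MeasurableSpace Ω] {P : Measure Ω}
    {S : ℕ → Ω → ℤ} (hS : IsBenjaminiProcess P S) {n : ℕ} {Φ Ψ c : (ℕ → ℤ) → ENNReal}
    (hΦ : DependsOn Φ (Set.Iic n)) (hΨ : DependsOn Ψ (Set.Iic (n + 1)))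
    (hc : DependsOn c (Set.Iic n))
    (hstep : ∀ x, ∑' y, jumpMass x n y * Ψ (Function.update x (n + 1) (x n + y)) ≤ Φ x + c x) :
    ∫⁻ ω, Ψ (fun k => S k ω) ∂P ≤
      ∫⁻ ω, Φ (fun k => S k ω) ∂P + ∫⁻ ω, c (fun k => S k ω) ∂P := by
  refine Benjamini.lintegral_succ_le hS.measurable (mass := fun x z => jumpMass x n (z - x n))
    (fun x y h => ?_) (hS.jump n) hΦ hΨ hc fun x => ?_
  · ext z
    simp only [jumpMass, h n (Set.mem_Iic.2 le_rfl)]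
    split_ifs with h1 h2 h2
    exacts [rfl, absurd ((isFresh_congr h).1 h1) h2, absurd ((isFresh_congr h).2 h2) h1, rfl]
  · refine le_of_eq_of_le ?_ (hstep x)
    rw [← (Equiv.addLeft (x n)).tsum_eq]
    simp

/-- The set of sites visited by the path `x` before time `n`. -/
def visited (x : ℕ → ℤ) (n : ℕ) : Finset ℤ := (Finset.range n).image x

theorem visited_congr {x y : ℕ → ℤ} {n : ℕ} (h : ∀ k < n, x k = y k) :
    visited x n = visited y n :=
  Finset.image_congr fun k hk => h k (by simpa using hk)

theorem visited_succ (x : ℕ → ℤ) (n : ℕ) : visited x (n + 1) = insert (x n) (visited x n) := by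
  rw [visited, Finset.range_add_one, Finset.image_insert, visited]

theorem notMem_visited_iff (x : ℕ → ℤ) (n : ℕ) : x n ∉ visited x n ↔ IsFresh x n := by
  simp [visited, IsFresh]

open Classical in
theorem card_visited_succ (x : ℕ → ℤ) (n : ℕ) :
    (visited x (n + 1)).card = (visited x n).card + if IsFresh x n then 1 else 0 := by
  rw [visited_succ]
  split_ifs with h
  · exact Finset.card_insert_of_notMem ((notMem_visited_iff x n).2 h)
  · exact Finset.card_insert_of_mem (not_not.1 (mt (notMem_visited_iff x n).1 h))

theorem dependsOn_visited (n : ℕ) : DependsOn (fun x => visited x n) (Set.Iic n) :=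
  fun _ _ h => visited_congr fun k hk => h k (Set.mem_Iic.2 hk.le)

/-! ### The range grows sublinearly -/

/-- Logarithmic interaction of the position at time `n` with all sites visited before. -/
def logEnergy (n : ℕ) (x : ℕ → ℤ) : ENNReal :=
  ∑ w ∈ visited x n, ENNReal.ofReal (logPotential (x n - w) 0)

theorem dependsOn_logEnergy (n : ℕ) : DependsOn (logEnergy n) (Set.Iic n) := fun x y h => by
  have h1 : visited x n = visited y n := dependsOn_visited n h
  simp only [logEnergy, h1, h n (Set.mem_Iic.2 le_rfl)]

/-- The energy grows by at most a constant per step, in mean: the terms of distinct sites have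
drifts at distinct arguments of the summable function `logDrift`, and a newly visited site
contributes `logPotential 0 0 = 0`. -/
theorem logEnergy_step (n : ℕ) (x : ℕ → ℤ) :
    ∑' y, jumpMass x n y * logEnergy (n + 1) (Function.update x (n + 1) (x n + y)) ≤
      logEnergy n x + ∑' z : ℤ, ENNReal.ofReal (logDrift z) := by
  have hvis : ∀ y, visited (Function.update x (n + 1) y) (n + 1) = visited x (n + 1) := fun y =>
    visited_congr fun k hk => Function.update_of_ne hk.ne _ _
  have hE : ∀ y, logEnergy (n + 1) (Function.update x (n + 1) (x n + y)) =
      ∑ w ∈ visited x (n + 1), ENNReal.ofReal (logPotential (x n - w + y) 0) := by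
    intro y
    rw [logEnergy, hvis, Function.update_self]
    exact Finset.sum_congr rfl fun w _ => by rw [show x n + y - w = x n - w + y by ring]
  simp_rw [hE, Finset.mul_sum]
  rw [Summable.tsum_finsetSum fun _ _ => ENNReal.summable]
  calc ∑ w ∈ visited x (n + 1),
        ∑' y, jumpMass x n y * ENNReal.ofReal (logPotential (x n - w + y) 0)
      ≤ ∑ w ∈ visited x (n + 1), (ENNReal.ofReal (logPotential (x n - w) 0) +
          ENNReal.ofReal (logDrift (x n - w))) :=
        Finset.sum_le_sum fun w _ => tsum_jumpMass_logPotential_le x n (x n - w)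
    _ = ∑ w ∈ visited x (n + 1), ENNReal.ofReal (logPotential (x n - w) 0) +
          ∑ w ∈ visited x (n + 1), ENNReal.ofReal (logDrift (x n - w)) := Finset.sum_add_distrib
    _ ≤ _ := by
        gcongr
        · rw [visited_succ, Finset.sum_insert_of_eq_zero_if_notMem, logEnergy]
          intro _
          simp [logPotential_zero_right]
        · rw [← (Equiv.subLeft (x n)).tsum_eq]
          exact ENNReal.sum_le_tsum (f := fun w => ENNReal.ofReal (logDrift (x n - w))) _

section Range

variable {Ω : Type*} [MeasurableSpace Ω] {P : Measure Ω} [IsProbabilityMeasure P] {S : ℕ → Ω → ℤ}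

theorem IsBenjaminiProcess.lintegral_logEnergy_le (hS : IsBenjaminiProcess P S) (n : ℕ) :
    ∫⁻ ω, logEnergy n (fun k => S k ω) ∂P ≤ n * ∑' z : ℤ, ENNReal.ofReal (logDrift z) := by
  induction n with
  | zero => simp [logEnergy, visited]
  | succ n ih =>
    have := hS.lintegral_succ_le (dependsOn_logEnergy n) (dependsOn_logEnergy (n + 1))
      (c := fun _ => ∑' z : ℤ, ENNReal.ofReal (logDrift z)) (fun _ _ _ => rfl) (logEnergy_step n)
    rw [lintegral_const, measure_univ, mul_one] at this
    push_cast
    rw [add_mul, one_mul]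
    exact this.trans (by gcongr)

/-- All but `2 m` visited sites are at distance at least `m` from the current position, and each
of these has energy at least `log (2 m² + 1)`. -/
theorem card_visited_mul_le (n m : ℕ) (x : ℕ → ℤ) :
    ((visited x n).card : ENNReal) * ENNReal.ofReal (Real.log (2 * m ^ 2 + 1)) ≤
      2 * m * ENNReal.ofReal (Real.log (2 * m ^ 2 + 1)) + logEnergy n x := by
  classical
  rw [← Finset.card_filter_add_card_filter_not (s := visited x n) (fun w => |x n - w| < m)]
  push_cast
  rw [add_mul]
  gcongr
  · have hsub : (visited x n).filter (fun w => |x n - w| < m) ⊆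
        Finset.Ico (x n - m) (x n + m) := by
      intro w hw
      have := abs_lt.1 (Finset.mem_filter.1 hw).2
      exact Finset.mem_Ico.2 ⟨by omega, by omega⟩
    have hcard := Finset.card_le_card hsub
    rw [Int.card_Ico, show (x n + m - (x n - m)).toNat = 2 * m by omega] at hcard
    exact_mod_cast hcard
  · rw [← nsmul_eq_mul]
    refine (Finset.card_nsmul_le_sum _ (fun w => ENNReal.ofReal (logPotential (x n - w) 0)) _
      fun w hw => ?_).trans (Finset.sum_le_sum_of_subset (Finset.filter_subset _ _))
    have hw' : (m : ℤ) ≤ |x n - w| := not_lt.1 (Finset.mem_filter.1 hw).2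
    have hw'' : (m : ℝ) ≤ |((x n - w : ℤ) : ℝ)| := by exact_mod_cast hw'
    rw [logPotential_zero_right]
    refine ENNReal.ofReal_le_ofReal (Real.log_le_log (by positivity) ?_)
    rw [← sq_abs ((x n - w : ℤ) : ℝ)]
    gcongr

/-- Mean number of sites visited before time `n`. -/
def meanRange (P : Measure Ω) (S : ℕ → Ω → ℤ) (n : ℕ) : ℝ :=
  (∫⁻ ω, ((visited (fun k => S k ω) n).card : ENNReal) ∂P).toReal

theorem lintegral_card_visited_ne_top (S : ℕ → Ω → ℤ) (n : ℕ) :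
    ∫⁻ ω, ((visited (fun k => S k ω) n).card : ENNReal) ∂P ≠ ⊤ := by
  refine ne_top_of_le_ne_top (ENNReal.natCast_ne_top n) ?_
  calc ∫⁻ ω, ((visited (fun k => S k ω) n).card : ENNReal) ∂P ≤ ∫⁻ _, (n : ENNReal) ∂P :=
        lintegral_mono fun ω => Nat.cast_le.2 (Finset.card_image_le.trans_eq (Finset.card_range n))
    _ = n := by simp

theorem dependsOn_card_visited (n : ℕ) :
    DependsOn (fun x => ((visited x n).card : ENNReal)) (Set.Iic n) := fun x y h => by
  have h1 : visited x n = visited y n := dependsOn_visited n h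
  simp only [h1]

theorem IsBenjaminiProcess.meanRange_mul_le (hS : IsBenjaminiProcess P S) (n m : ℕ) :
    meanRange P S n * Real.log (2 * m ^ 2 + 1) ≤
      2 * m * Real.log (2 * m ^ 2 + 1) + n * (∑' z : ℤ, ENNReal.ofReal (logDrift z)).toReal := by
  have hl : 0 ≤ Real.log (2 * (m : ℝ) ^ 2 + 1) := Real.log_nonneg (by nlinarith [sq_nonneg (m : ℝ)])
  have key : (∫⁻ ω, ((visited (fun k => S k ω) n).card : ENNReal) ∂P) *
      ENNReal.ofReal (Real.log (2 * m ^ 2 + 1)) ≤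
      2 * m * ENNReal.ofReal (Real.log (2 * m ^ 2 + 1)) +
        n * ∑' z : ℤ, ENNReal.ofReal (logDrift z) := by
    calc _ = ∫⁻ ω, ((visited (fun k => S k ω) n).card : ENNReal) *
          ENNReal.ofReal (Real.log (2 * m ^ 2 + 1)) ∂P :=
          (lintegral_mul_const' _ _ ENNReal.ofReal_ne_top).symm
      _ ≤ ∫⁻ ω, (2 * m * ENNReal.ofReal (Real.log (2 * m ^ 2 + 1)) +
          logEnergy n (fun k => S k ω)) ∂P :=
          lintegral_mono fun ω => card_visited_mul_le n m _
      _ = 2 * m * ENNReal.ofReal (Real.log (2 * m ^ 2 + 1)) +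
          ∫⁻ ω, logEnergy n (fun k => S k ω) ∂P := by
          rw [lintegral_add_left measurable_const]
          simp
      _ ≤ _ := by gcongr; exact hS.lintegral_logEnergy_le n
  have hK := tsum_logDrift_ne_top
  have hfin : 2 * (m : ENNReal) * ENNReal.ofReal (Real.log (2 * m ^ 2 + 1)) ≠ ⊤ := by finiteness
  have hfin' : (n : ENNReal) * ∑' z : ℤ, ENNReal.ofReal (logDrift z) ≠ ⊤ := by finiteness
  have := ENNReal.toReal_mono (ENNReal.add_ne_top.2 ⟨hfin, hfin'⟩) key
  rw [ENNReal.toReal_add hfin hfin'] at this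
  simpa [ENNReal.toReal_mul, ENNReal.toReal_ofReal hl, meanRange] using this

theorem IsBenjaminiProcess.tendsto_meanRange_div (hS : IsBenjaminiProcess P S) :
    Tendsto (fun n : ℕ => meanRange P S n / n) atTop (𝓝 0) := by
  set K := (∑' z : ℤ, ENNReal.ofReal (logDrift z)).toReal with hK
  have hlog : Tendsto (fun m : ℕ => Real.log (2 * (m : ℝ) ^ 2 + 1)) atTop atTop := by
    refine Real.tendsto_log_atTop.comp (tendsto_atTop_mono (fun m => ?_) tendsto_natCast_atTop_atTop)
    rcases Nat.eq_zero_or_pos m with rfl | hm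
    · norm_num
    · have : (1 : ℝ) ≤ m := by exact_mod_cast hm
      nlinarith
  have hdiv : Tendsto (fun m : ℕ => K / Real.log (2 * (m : ℝ) ^ 2 + 1)) atTop (𝓝 0) :=
    hlog.const_div_atTop K
  rw [Metric.tendsto_atTop]
  intro ε hε
  obtain ⟨m, hm1, hm2⟩ := ((hdiv.eventually_lt_const (half_pos hε)).and
    (hlog.eventually_gt_atTop 0)).exists
  have hn : Tendsto (fun n : ℕ => 2 * (m : ℝ) / n) atTop (𝓝 0) :=
    tendsto_const_div_atTop_nhds_zero_nat _
  obtain ⟨N, hN⟩ := eventually_atTop.1 ((hn.eventually_lt_const (half_pos hε)).and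
    (eventually_gt_atTop 0))
  refine ⟨N, fun n hnN => ?_⟩
  obtain ⟨h1, h2⟩ := hN n hnN
  have hn0 : (0 : ℝ) < n := by exact_mod_cast h2
  have hR : 0 ≤ meanRange P S n := ENNReal.toReal_nonneg
  rw [Real.dist_eq, sub_zero, abs_of_nonneg (by positivity)]
  have hle : meanRange P S n ≤ 2 * m + n * (K / Real.log (2 * (m : ℝ) ^ 2 + 1)) := by
    have := hS.meanRange_mul_le n m
    rw [← hK] at this
    rw [← mul_le_mul_iff_left₀ hm2]
    refine this.trans_eq ?_
    field_simp
  calc meanRange P S n / n ≤ (2 * m + n * (K / Real.log (2 * (m : ℝ) ^ 2 + 1))) / n := by gcongr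
    _ = 2 * m / n + K / Real.log (2 * (m : ℝ) ^ 2 + 1) := by field_simp
    _ < ε := by linarith

/-! ### The maximal displacement -/

open Classical in
/-- The truncated squared displacement `min ((x n - x 0)²) (L²)`, frozen at `L²` from the first
time the displacement reaches `L`. -/
def exitEnergy (L n : ℕ) (x : ℕ → ℤ) : ENNReal :=
  if ∃ t ≤ n, (L : ℤ) ≤ |x t - x 0| then (L : ENNReal) ^ 2
  else ENNReal.ofReal (truncQuad L (x n - x 0) 0)

theorem exists_displacement_congr {L n : ℕ} {x y : ℕ → ℤ} (h : ∀ k ∈ Set.Iic n, x k = y k) :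
    (∃ t ≤ n, (L : ℤ) ≤ |x t - x 0|) ↔ ∃ t ≤ n, (L : ℤ) ≤ |y t - y 0| :=
  exists_congr fun t => and_congr_right fun ht => by
    rw [h t (Set.mem_Iic.2 ht), h 0 (Set.mem_Iic.2 n.zero_le)]

theorem dependsOn_exitEnergy (L n : ℕ) : DependsOn (exitEnergy L n) (Set.Iic n) :=
  fun x y h => by
    unfold exitEnergy
    refine if_congr (exists_displacement_congr h) rfl ?_
    rw [h n (Set.mem_Iic.2 le_rfl), h 0 (Set.mem_Iic.2 n.zero_le)]

theorem ofReal_truncQuad_le (L : ℕ) (x y : ℤ) :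
    ENNReal.ofReal (truncQuad L x y) ≤ (L : ENNReal) ^ 2 := by
  refine (ENNReal.ofReal_le_ofReal (truncQuad_le L x y)).trans_eq ?_
  rw [ENNReal.ofReal_pow (by positivity), ENNReal.ofReal_natCast]

theorem exitEnergy_le (L n : ℕ) (x : ℕ → ℤ) : exitEnergy L n x ≤ (L : ENNReal) ^ 2 := by
  unfold exitEnergy
  split_ifs
  exacts [le_rfl, ofReal_truncQuad_le _ _ _]

open Classical in
theorem exitEnergy_step {L : ℕ} (hL : 0 < L) (n : ℕ) (x : ℕ → ℤ) :
    ∑' y, jumpMass x n y * exitEnergy L (n + 1) (Function.update x (n + 1) (x n + y)) ≤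
      exitEnergy L n x + (L * (if IsFresh x n then 1 else 0) + 1) := by
  by_cases h : ∃ t ≤ n, (L : ℤ) ≤ |x t - x 0|
  · calc _ ≤ ∑' y, jumpMass x n y * (L : ENNReal) ^ 2 :=
          ENNReal.tsum_le_tsum fun y => by gcongr; exact exitEnergy_le _ _ _
      _ = (∑' y, jumpMass x n y) * (L : ENNReal) ^ 2 := ENNReal.tsum_mul_right
      _ ≤ 1 * (L : ENNReal) ^ 2 := by gcongr; exact tsum_jumpMass_le_one x n
      _ = exitEnergy L n x := by rw [one_mul, exitEnergy, if_pos h]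
      _ ≤ _ := le_self_add
  · have hE : ∀ y, exitEnergy L (n + 1) (Function.update x (n + 1) (x n + y)) =
        ENNReal.ofReal (truncQuad L (x n - x 0 + y) 0) := by
      intro y
      have hx0 : Function.update x (n + 1) (x n + y) 0 = x 0 :=
        Function.update_of_ne (by omega) _ _
      have hiff : (∃ t ≤ n + 1, (L : ℤ) ≤ |Function.update x (n + 1) (x n + y) t -
          Function.update x (n + 1) (x n + y) 0|) ↔ (L : ℤ) ≤ |x n - x 0 + y| := by
        rw [hx0]
        constructor
        · rintro ⟨t, ht, hle⟩
          rcases Nat.lt_or_ge n t with hlt | hge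
          · obtain rfl : t = n + 1 := by omega
            rw [Function.update_self] at hle
            rwa [show x n - x 0 + y = x n + y - x 0 by ring]
          · rw [Function.update_of_ne (by omega)] at hle
            exact absurd ⟨t, hge, hle⟩ h
        · intro hle
          refine ⟨n + 1, le_rfl, ?_⟩
          rwa [Function.update_self, show x n + y - x 0 = x n - x 0 + y by ring]
      rw [exitEnergy, hx0, Function.update_self, show x n + y - x 0 = x n - x 0 + y by ring]
      split_ifs with h'
      · have hle : (L : ℝ) ≤ |((x n - x 0 + y : ℤ) : ℝ)| := by exact_mod_cast hiff.1 h'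
        have : (L : ℝ) ^ 2 ≤ ((x n - x 0 + y : ℤ) : ℝ) ^ 2 := by
          rw [← sq_abs ((x n - x 0 + y : ℤ) : ℝ)]
          gcongr
        rw [truncQuad_zero_right hL, min_eq_right this, ENNReal.ofReal_pow (by positivity),
          ENNReal.ofReal_natCast]
      · rfl
    simp_rw [hE]
    rw [exitEnergy, if_neg h]
    exact tsum_jumpMass_truncQuad_le hL x n _

open Classical in
theorem IsBenjaminiProcess.lintegral_exitEnergy_le (hS : IsBenjaminiProcess P S) {L : ℕ}
    (hL : 0 < L) (n : ℕ) :
    ∫⁻ ω, exitEnergy L n (fun k => S k ω) ∂P ≤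
      L * ∫⁻ ω, ((visited (fun k => S k ω) n).card : ENNReal) ∂P + n := by
  have hmeas : ∀ n, Measurable fun ω => ((visited (fun k => S k ω) n).card : ENNReal) :=
    fun n => measurable_comp_of_dependsOn hS.measurable (dependsOn_card_visited n)
  induction n with
  | zero =>
    have h0 : truncQuad L 0 0 = 0 := by simp [truncQuad_zero_right hL]
    simp [exitEnergy, h0, hL.ne']
  | succ n ih =>
    have hdep : DependsOn (fun x : ℕ → ℤ => (L : ENNReal) * (if IsFresh x n then 1 else 0) + 1)
        (Set.Iic n) := fun x y h => by simp only [isFresh_congr h]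
    have hmc : Measurable fun ω => (if IsFresh (fun k => S k ω) n then 1 else 0 : ENNReal) :=
      measurable_comp_of_dependsOn hS.measurable (n := n)
        (f := fun x => (if IsFresh x n then 1 else 0 : ENNReal))
        fun x y h => by simp only [isFresh_congr h]
    have := hS.lintegral_succ_le (dependsOn_exitEnergy L n) (dependsOn_exitEnergy L (n + 1)) hdep
      (exitEnergy_step hL n)
    refine this.trans ((add_le_add_left ih _).trans_eq ?_)
    have hcard : ∀ ω, ((visited (fun k => S k ω) (n + 1)).card : ENNReal) =
        (visited (fun k => S k ω) n).card + if IsFresh (fun k => S k ω) n then 1 else 0 := by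
      intro ω
      rw [card_visited_succ]
      push_cast
      rfl
    simp_rw [hcard]
    rw [lintegral_add_right _ measurable_const, lintegral_const_mul _ hmc, lintegral_add_left (hmeas n)]
    simp only [lintegral_const, measure_univ, mul_one, Nat.cast_add, Nat.cast_one]
    ring

theorem IsBenjaminiProcess.measure_displacement_le (hS : IsBenjaminiProcess P S) {L : ℕ}
    (hL : 0 < L) (n : ℕ) :
    P {ω | ∃ t ≤ n, (L : ℤ) ≤ |S t ω - S 0 ω|} ≤
      ENNReal.ofReal (meanRange P S n / L + n / (L : ℝ) ^ 2) := by
  have hL' : (0 : ℝ) < L := by exact_mod_cast hL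
  have hmarkov := mul_meas_ge_le_lintegral (μ := P)
    (measurable_comp_of_dependsOn hS.measurable (dependsOn_exitEnergy L n)) ((L : ENNReal) ^ 2)
  have hsub : {ω | ∃ t ≤ n, (L : ℤ) ≤ |S t ω - S 0 ω|} ⊆
      {ω | (L : ENNReal) ^ 2 ≤ exitEnergy L n (fun k => S k ω)} := by
    intro ω (hω : ∃ t ≤ n, (L : ℤ) ≤ |S t ω - S 0 ω|)
    change (L : ENNReal) ^ 2 ≤ exitEnergy L n (fun k => S k ω)
    rw [exitEnergy, if_pos hω]
  have hR : 0 ≤ meanRange P S n := ENNReal.toReal_nonneg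
  have hint : ∫⁻ ω, ((visited (fun k => S k ω) n).card : ENNReal) ∂P =
      ENNReal.ofReal (meanRange P S n) :=
    (ENNReal.ofReal_toReal (lintegral_card_visited_ne_top S n)).symm
  have h := (mul_le_mul_right (measure_mono (μ := P) hsub) ((L : ENNReal) ^ 2)).trans
    (hmarkov.trans (hS.lintegral_exitEnergy_le hL n))
  rw [hint, ← ENNReal.ofReal_natCast L, ← ENNReal.ofReal_natCast n,
    ← ENNReal.ofReal_pow hL'.le, ← ENNReal.ofReal_mul hL'.le,
    ← ENNReal.ofReal_add (by positivity) (by positivity),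
    mul_comm (ENNReal.ofReal _), ← ENNReal.le_div_iff_mul_le (by simp [hL.ne']) (by simp),
    ← ENNReal.ofReal_div_of_pos (by positivity)] at h
  refine h.trans_eq ?_
  congr 1
  field_simp

theorem tendsto_measure_natCast_le_abs {X : Ω → ℤ} (hX : Measurable X) :
    Tendsto (fun L : ℕ => P {ω | (L : ℤ) ≤ |X ω|}) atTop (𝓝 0) := by
  have hm : ∀ L : ℕ, MeasurableSet {ω | (L : ℤ) ≤ |X ω|} := fun L =>
    hX (MeasurableSet.of_discrete (s := {z : ℤ | (L : ℤ) ≤ |z|}))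
  have := tendsto_measure_iInter_atTop (μ := P) (fun L => (hm L).nullMeasurableSet)
    (fun L L' h ω (hω : (L' : ℤ) ≤ |X ω|) => show (L : ℤ) ≤ |X ω| by
      have : (L : ℤ) ≤ L' := by exact_mod_cast h
      omega) ⟨0, measure_ne_top _ _⟩
  have hempty : ⋂ L : ℕ, {ω | (L : ℤ) ≤ |X ω|} = ∅ := by
    refine Set.eq_empty_of_forall_notMem fun ω hω => ?_
    have h : (((X ω).natAbs + 1 : ℕ) : ℤ) ≤ |X ω| := Set.mem_iInter.1 hω ((X ω).natAbs + 1)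
    push_cast at h
    omega
  rwa [hempty, measure_empty] at this

end Range

theorem runningMax_subset {ε : ℝ} {n : ℕ} (hn : 0 < n) {Ω : Type*} (S : ℕ → Ω → ℤ) :
    {ω | ε ≤ ‖1 / (n : ℝ) * runningMax S n ω - 0‖} ⊆
      {ω | ((⌊ε / 2 * n⌋₊ : ℕ) : ℤ) ≤ |S 0 ω|} ∪
        {ω | ∃ t ≤ n, ((⌊ε / 2 * n⌋₊ : ℕ) : ℤ) ≤ |S t ω - S 0 ω|} := by
  intro ω hω
  obtain ⟨t, ht, hmax⟩ := Finset.exists_mem_eq_sup' (Finset.nonempty_range_add_one (n := n))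
    fun t => |(S t ω : ℝ)|
  have hn' : (0 : ℝ) < n := by exact_mod_cast hn
  have hω' : ε ≤ ‖1 / (n : ℝ) * runningMax S n ω - 0‖ := hω
  rw [runningMax, hmax, sub_zero, Real.norm_of_nonneg (by positivity), one_div_mul_eq_div,
    le_div_iff₀ hn'] at hω'
  by_contra hcon
  simp only [Set.mem_union, Set.mem_ofPred_eq, not_or, not_exists, not_and, not_le] at hcon
  obtain ⟨h0, h1⟩ := hcon
  have h1' := h1 t (Nat.lt_succ_iff.1 (Finset.mem_range.1 ht))
  have hpos : 0 < ⌊ε / 2 * n⌋₊ := by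
    have := abs_nonneg (S 0 ω)
    omega
  have hfl : (⌊ε / 2 * n⌋₊ : ℝ) ≤ ε / 2 * n :=
    Nat.floor_le (le_trans zero_le_one ((Nat.floor_pos).1 hpos))
  have hsum : |S t ω| < 2 * ((⌊ε / 2 * n⌋₊ : ℕ) : ℤ) := by
    have := abs_add_le (S t ω - S 0 ω) (S 0 ω)
    rw [sub_add_cancel] at this
    omega
  have hsum' : |(S t ω : ℝ)| < 2 * (⌊ε / 2 * n⌋₊ : ℝ) := by exact_mod_cast hsum
  linarith

end Benjamini

end

theorem mainTheorem3 {Ω : Type*} [MeasurableSpace Ω] (P : Measure Ω) [IsProbabilityMeasure P]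
    (S : ℕ → Ω → ℤ) (hS : Benjamini.IsBenjaminiProcess P S) :
    TendstoInMeasure P (fun (n : ℕ) (ω : Ω) => (1 / (n : ℝ)) * Benjamini.runningMax S n ω)
      atTop (fun _ => (0 : ℝ)) := by
  rw [tendstoInMeasure_iff_norm]
  intro ε hε
  set L : ℕ → ℕ := fun n => ⌊ε / 2 * n⌋₊ with hLdef
  have hL : Tendsto L atTop atTop :=
    tendsto_nat_floor_atTop.comp
      (tendsto_natCast_atTop_atTop.const_mul_atTop (half_pos hε))
  have hratio : Tendsto (fun n : ℕ => (n : ℝ) / L n) atTop (𝓝 (ε / 2)⁻¹) := by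
    have h := ((tendsto_nat_floor_mul_div_atTop (half_pos hε).le).comp
      (tendsto_natCast_atTop_atTop (R := ℝ))).inv₀ (half_pos hε).ne'
    refine h.congr fun n => ?_
    simp [hLdef]
  have hbound : Tendsto (fun n : ℕ => Benjamini.meanRange P S n / L n + n / (L n : ℝ) ^ 2) atTop
      (𝓝 0) := by
    have h1 := hS.tendsto_meanRange_div.mul hratio
    have h2 := (hratio.mul hratio).mul (tendsto_one_div_atTop_nhds_zero_nat (𝕜 := ℝ))
    have h3 := h1.add h2
    simp only [zero_mul, mul_zero, add_zero] at h3
    refine h3.congr' ?_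
    filter_upwards [eventually_gt_atTop 0, hL.eventually_gt_atTop 0] with n hn hLn
    have hn' : (n : ℝ) ≠ 0 := by exact_mod_cast hn.ne'
    have hLn' : (L n : ℝ) ≠ 0 := by exact_mod_cast hLn.ne'
    field_simp
  have hup := ((Benjamini.tendsto_measure_natCast_le_abs (P := P) (hS.measurable 0)).comp hL).add
    (ENNReal.tendsto_ofReal hbound)
  rw [ENNReal.ofReal_zero, add_zero] at hup
  refine tendsto_of_tendsto_of_tendsto_of_le_of_le' tendsto_const_nhds hup
    (Eventually.of_forall fun _ => bot_le) ?_
  filter_upwards [eventually_gt_atTop 0, hL.eventually_gt_atTop 0] with n hn hLn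
  refine (measure_mono (Benjamini.runningMax_subset hn S)).trans ((measure_union_le _ _).trans ?_)
  exact add_le_add le_rfl (hS.measure_displacement_le hLn n)
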